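/- Let $\mathcal L$ be a first-order language, let $\kappa$ be an infinite cardinal, and let $M$ be a $\kappa$-saturated $\mathcal L$-structure whose complete theory is NIP (for example, a monster model of an NIP theory). Here $\kappa$-saturated means that for every $B\subseteq M$ with $|B|<\kappa$, every set of formulas over $B$ in finitely many variables which is finitely satisfiable in $M$ is realized in $M$; and NIP means that for every formula $\varphi(x;y)$ without parameters ($x,y$ finite tuples of variables) there is $N\in\mathbb N$ such that there are no tuples $a_i$ $(i<N)$ and $b_S$ $(S\subseteq\{0,\dots,N-1\})$ in $M$ with $M\models\varphi(a_i;b_S)\iff i\in S$. Let $K$ be an infinite field of characteristic $p>0$ that is type-definable in $M$ over a set $A\subseteq M$ with $|A|<\kappa$; that is, the underlying set of $K$ is a subset of $M^n$ for some $n\in\mathbb N$, and this set and the graphs of addition and multiplication of $K$ are each the set of realizations in $M$ of a partial type over $A$. Then $K$ is Artin–Schreier closed: every field extension of the form $K(\alpha)/K$ with $\alpha^p-\alpha\in K$ is trivial, and, equivalently, the map $K\to K$, $x\mapsto x^p-x$, is surjective. -/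

import Mathlib

universe u v w

namespace NIPField

open FirstOrder FirstOrder.Language Cardinal

section ModelTheory

variable (L : FirstOrder.Language.{u, v}) (M : Type w) [L.Structure M]

/-- `M` is `κ`-saturated: for every `A ⊆ M` with `|A| < κ`, every set of formulas with parameters
in `A`, in finitely many free variables, that is finitely satisfiable in `M` is realized in `M`. -/
def IsSaturated (κ : Cardinal.{w}) : Prop :=
  ∀ A : Set M, #A < κ → ∀ (n : ℕ) (q : Set (L[[A]].Formula (Fin n))),
    (∀ s : Finset (L[[A]].Formula (Fin n)), (s : Set (L[[A]].Formula (Fin n))) ⊆ q →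
      ∃ a : Fin n → M, ∀ φ ∈ s, φ.Realize a) →
    ∃ a : Fin n → M, ∀ φ ∈ q, φ.Realize a

/-- The partitioned formula `φ(x; y)` shatters some `N`-element family in `M`: there are tuples
`a i` for `i < N` and `b S` for `S ⊆ {0, …, N - 1}` with `M ⊨ φ(a i; b S)` iff `i ∈ S`. -/
def ShattersCard {k m : ℕ} (φ : L.Formula (Fin k ⊕ Fin m)) (N : ℕ) : Prop :=
  ∃ (a : Fin N → Fin k → M) (b : Set (Fin N) → Fin m → M),
    ∀ (i : Fin N) (S : Set (Fin N)), φ.Realize (Sum.elim (a i) (b S)) ↔ i ∈ S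

/-- `M` is an NIP structure (equivalently, the complete theory of `M` is NIP): no partitioned
formula has the independence property, which by compactness means that no partitioned formula
shatters arbitrarily large finite families in `M`. -/
def IsNIP : Prop :=
  ∀ (k m : ℕ) (φ : L.Formula (Fin k ⊕ Fin m)), ∃ N : ℕ, ¬ ShattersCard L M φ N

variable {M}

/-- A subset of a Cartesian power of `M` is type-definable over `A` if it is the set of realizations
of a partial type over `A`, i.e. an intersection of sets definable over `A`. -/
def TypeDefinable (A : Set M) {α : Type*} (s : Set (α → M)) : Prop :=
  ∃ q : Set (L[[A]].Formula α), s = {x | ∀ φ ∈ q, φ.Realize x}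

/-- The graph of a binary operation on a set of `n`-tuples, as a set of `3n`-tuples. -/
def opGraph {n : ℕ} {K : Set (Fin n → M)} (f : K → K → K) :
    Set ((Fin n ⊕ (Fin n ⊕ Fin n)) → M) :=
  {v | ∃ x y : K, v = Sum.elim (x : Fin n → M) (Sum.elim (y : Fin n → M) (f x y : Fin n → M))}

/-- The field `K`, with underlying set a set of `n`-tuples from `M`, is a type-definable field over
`A`: the underlying set and the graphs of addition and multiplication are type-definable
over `A`. -/
structure IsTypeDefinableField (A : Set M) {n : ℕ} (K : Set (Fin n → M)) [Field K] : Prop where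
  carrier : TypeDefinable L A K
  add_graph : TypeDefinable L A (opGraph (fun x y : K => x + y))
  mul_graph : TypeDefinable L A (opGraph (fun x y : K => x * y))

end ModelTheory

/-- `K` (of characteristic `p`) is Artin-Schreier closed: it has no Artin-Schreier extension, i.e.
every extension of the form `K(α)` with `α ^ p - α ∈ K` is trivial. -/
def IsArtinSchreierClosed (p : ℕ) (K : Type u) [Field K] : Prop :=
  ∀ (E : Type u) [Field E] [Algebra K E] (α : E),
    α ^ p - α ∈ (algebraMap K E).range → IntermediateField.adjoin K {α} = ⊥

end NIPField

namespace NIPField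
open FirstOrder FirstOrder.Language Cardinal

/-! ### Compactness for type-definable sets in a saturated structure, and NIP with parameters -/

section Saturation

variable {L : FirstOrder.Language.{u, v}} {M : Type w} [L.Structure M] {κ : Cardinal.{w}}
  {A B : Set M} {α β : Type*}

/-! Let `H` be the image of `x ↦ x ^ p - x` and suppose `u ∉ H`. The relations `b * t ∈ u + H` and
`b * t ∈ H` are disjoint, and both are type-definable, since saturation makes projections
type-definable. By compactness a definable set `D` separates them
(`IsSaturated.exists_definable_separating`).

But `D` shatters families of every finite size, against NIP: for each `N` there are `b j` (`j < N`)
such that any prescribed residues of the `b j * t` modulo `H`, in particular any pattern of `0` and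
`u`, are attained by a single `t` (`exists_mul_sub_mem_artinSchreierRange`). This rests on the
invertibility of Moore matrices and on `x ^ p ^ k ≡ x` modulo `H`. No chain condition on subgroups
is needed. -/

theorem typeDefinable_iff_exists_sInter {s : Set (α → M)} : TypeDefinable L A s ↔
    ∃ 𝒮 : Set (Set (α → M)), (∀ D ∈ 𝒮, A.Definable L D) ∧ s = ⋂₀ 𝒮 := by
  constructor
  · rintro ⟨q, rfl⟩
    refine ⟨(fun φ : L[[A]].Formula α => {x | φ.Realize x}) '' q, ?_, ?_⟩
    · rintro _ ⟨φ, -, rfl⟩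
      exact ⟨φ, rfl⟩
    · ext x
      simp
  · rintro ⟨𝒮, h𝒮, rfl⟩
    refine ⟨{φ | {x | φ.Realize x} ∈ 𝒮}, ?_⟩
    ext x
    refine ⟨fun hx φ hφ => hx _ hφ, fun hx D hD => ?_⟩
    obtain ⟨φ, rfl⟩ := h𝒮 D hD
    exact hx φ hD

theorem _root_.Set.Definable.typeDefinable {s : Set (α → M)} (hs : A.Definable L s) :
    TypeDefinable L A s :=
  typeDefinable_iff_exists_sInter.2 ⟨{s}, by simpa using hs, by simp⟩

theorem TypeDefinable.iInter {ι : Type*} {s : ι → Set (α → M)}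
    (hs : ∀ i, TypeDefinable L A (s i)) : TypeDefinable L A (⋂ i, s i) := by
  choose q hq using hs
  refine ⟨⋃ i, q i, ?_⟩
  ext x
  simp only [hq, Set.mem_iInter, Set.mem_iUnion, Set.mem_ofPred_eq]
  exact ⟨fun h φ ⟨i, hi⟩ => h i φ hi, fun h i φ hi => h φ ⟨i, hi⟩⟩

theorem TypeDefinable.inter {s t : Set (α → M)} (hs : TypeDefinable L A s)
    (ht : TypeDefinable L A t) : TypeDefinable L A (s ∩ t) := by
  rw [Set.inter_eq_iInter]
  exact TypeDefinable.iInter (by rintro (_ | _) <;> assumption)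

theorem TypeDefinable.mono {s : Set (α → M)} (hs : TypeDefinable L A s) (h : A ⊆ B) :
    TypeDefinable L B s := by
  rw [typeDefinable_iff_exists_sInter] at hs ⊢
  obtain ⟨𝒮, h𝒮, rfl⟩ := hs
  exact ⟨𝒮, fun D hD => (h𝒮 D hD).mono h, rfl⟩

theorem TypeDefinable.preimage_comp {s : Set (α → M)} (hs : TypeDefinable L A s) (f : α → β) :
    TypeDefinable L A ((fun g : β → M => g ∘ f) ⁻¹' s) := by
  rw [typeDefinable_iff_exists_sInter] at hs ⊢
  obtain ⟨𝒮, h𝒮, rfl⟩ := hs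
  refine ⟨(fun D => (fun g : β → M => g ∘ f) ⁻¹' D) '' 𝒮, ?_, ?_⟩
  · rintro _ ⟨D, hD, rfl⟩
    exact (h𝒮 D hD).preimage_comp f
  · ext x
    simp

theorem definable_setOf_apply_eq {c : M} (hc : c ∈ A) (i : α) :
    A.Definable L {x : α → M | x i = c} :=
  (Set.Definable.singleton_of_mem L hc).preimage_comp fun _ : Fin 1 => i

theorem definable_sInter_finset {F : Finset (Set (α → M))} (h : ∀ D ∈ F, A.Definable L D) :
    A.Definable L (⋂₀ (F : Set (Set (α → M)))) := by
  rw [Set.sInter_eq_iInter]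
  exact Set.definable_iInter_of_finite fun D => h D D.2

theorem IsSaturated.sInter_nonempty (hsat : IsSaturated L M κ) (hA : #A < κ) [Finite α]
    {𝒮 : Set (Set (α → M))} (h𝒮 : ∀ D ∈ 𝒮, A.Definable L D)
    (hfin : ∀ F : Finset (Set (α → M)), (F : Set (Set (α → M))) ⊆ 𝒮 →
      (⋂₀ (F : Set (Set (α → M)))).Nonempty) : (⋂₀ 𝒮).Nonempty := by
  classical
  obtain ⟨n, ⟨e⟩⟩ := Finite.exists_equiv_fin α
  let S : L[[A]].Formula (Fin n) → Set (α → M) := fun φ => {x | φ.Realize (x ∘ e.symm)}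
  obtain ⟨a, ha⟩ := hsat A hA n {φ | S φ ∈ 𝒮} fun s hs => by
    obtain ⟨x, hx⟩ := hfin (s.image S) (by
      intro D hD
      obtain ⟨φ, hφ, rfl⟩ := Finset.mem_image.1 (Finset.mem_coe.1 hD)
      exact hs hφ)
    exact ⟨x ∘ e.symm, fun φ hφ => hx (S φ) (Finset.mem_coe.2 (Finset.mem_image_of_mem S hφ))⟩
  refine ⟨a ∘ e, fun D hD => ?_⟩
  obtain ⟨φ, hφ⟩ := (h𝒮 D hD).preimage_comp (fun i : α => e i)
  have hS : S φ = D := by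
    ext x
    have := Set.ext_iff.1 hφ (x ∘ e.symm)
    simpa [Function.comp_def, S] using this.symm
  have := ha φ (by simpa [hS] using hD)
  rw [← hS]
  simpa [S, Function.comp_def] using this

/-- Disjoint type-definable sets are separated by a definable set. -/
theorem IsSaturated.exists_definable_separating (hsat : IsSaturated L M κ) (hA : #A < κ) [Finite α]
    {s t : Set (α → M)} (hs : TypeDefinable L A s) (ht : TypeDefinable L A t)
    (hst : Disjoint s t) : ∃ D, A.Definable L D ∧ s ⊆ D ∧ Disjoint D t := by
  classical
  obtain ⟨𝒮, h𝒮, rfl⟩ := typeDefinable_iff_exists_sInter.1 hs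
  obtain ⟨𝒯, h𝒯, rfl⟩ := typeDefinable_iff_exists_sInter.1 ht
  by_contra! H
  obtain ⟨x, hx⟩ := hsat.sInter_nonempty hA (𝒮 := 𝒮 ∪ 𝒯)
    (fun D hD => hD.elim (h𝒮 D) (h𝒯 D)) fun F hF => by
      have hF' : ∀ D ∈ F.filter (· ∈ 𝒮), D ∈ 𝒮 := fun D hD => (Finset.mem_filter.1 hD).2
      -- A finite intersection from `𝒮` is definable and contains `⋂₀ 𝒮`; as it fails to separate,
      -- it meets all of `⋂₀ 𝒯`.
      have := H (⋂₀ (F.filter (· ∈ 𝒮) : Finset (Set (α → M))))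
        (definable_sInter_finset fun D hD => h𝒮 D (hF' D hD))
        (Set.sInter_subset_sInter fun D hD => hF' D hD)
      obtain ⟨x, hx, hx'⟩ := Set.not_disjoint_iff.1 this
      refine ⟨x, fun D hD => ?_⟩
      by_cases h : D ∈ 𝒮
      · exact hx D (Finset.mem_coe.2 (Finset.mem_filter.2 ⟨hD, h⟩))
      · exact hx' D ((hF hD).resolve_left h)
  exact Set.disjoint_left.1 hst (fun D hD => hx D (Or.inl hD)) fun D hD => hx D (Or.inr hD)

theorem mk_union_range_lt (hκ : ℵ₀ ≤ κ) (hA : #A < κ) [Finite α] (x : α → M) :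
    #(A ∪ Set.range x : Set M) < κ :=
  (mk_union_le _ _).trans_lt
    (add_lt_of_lt hκ hA ((lt_aleph0_of_finite (Set.range x)).trans_le hκ))

/-- In a saturated structure, projections of type-definable sets are type-definable. -/
theorem IsSaturated.typeDefinable_image_comp (hsat : IsSaturated L M κ) (hκ : ℵ₀ ≤ κ) (hA : #A < κ)
    [Finite α] [Finite β] {s : Set (β → M)} (hs : TypeDefinable L A s) (f : α → β) :
    TypeDefinable L A ((fun g : β → M => g ∘ f) '' s) := by
  classical
  obtain ⟨𝒮, h𝒮, rfl⟩ := typeDefinable_iff_exists_sInter.1 hs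
  refine typeDefinable_iff_exists_sInter.2
    ⟨{T | ∃ F : Finset (Set (β → M)), (F : Set (Set (β → M))) ⊆ 𝒮 ∧
      T = (fun g : β → M => g ∘ f) '' ⋂₀ (F : Set (Set (β → M)))}, ?_, ?_⟩
  · rintro _ ⟨F, hF, rfl⟩
    exact (definable_sInter_finset fun D hD => h𝒮 D (hF hD)).image_comp f
  refine Set.Subset.antisymm ?_ fun x hx => ?_
  · rintro _ ⟨g, hg, rfl⟩ _ ⟨F, hF, rfl⟩
    exact ⟨g, fun D hD => hg D (hF hD), rfl⟩
  -- The fibre over `x` is cut out with the coordinates of `x` as finitely many extra parameters.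
  · obtain ⟨g, hg⟩ := hsat.sInter_nonempty (mk_union_range_lt hκ hA x)
      (𝒮 := 𝒮 ∪ Set.range fun i : α => {g : β → M | g (f i) = x i})
      (by
        rintro D (hD | ⟨i, rfl⟩)
        · exact (h𝒮 D hD).mono Set.subset_union_left
        · exact definable_setOf_apply_eq (Set.mem_union_right A (Set.mem_range_self i)) (f i))
      fun F hF => by
        have hF' : ((F.filter (· ∈ 𝒮) : Finset (Set (β → M))) : Set (Set (β → M))) ⊆ 𝒮 :=
          fun D hD => (Finset.mem_filter.1 (Finset.mem_coe.1 hD)).2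
        obtain ⟨g, hg, hgx⟩ := Set.mem_sInter.1 hx _ (Exists.intro _ ⟨hF', rfl⟩)
        refine ⟨g, fun D hD => ?_⟩
        by_cases h : D ∈ 𝒮
        · exact hg D (Finset.mem_coe.2 (Finset.mem_filter.2 ⟨hD, h⟩))
        · obtain ⟨i, rfl⟩ := (hF hD).resolve_left h
          exact congrFun hgx i
    exact ⟨g, fun D hD => hg D (Or.inl hD), funext fun i => hg _ (Or.inr ⟨i, rfl⟩)⟩

/-- In an NIP structure no relation definable with parameters shatters arbitrarily large families. -/
theorem IsNIP.exists_not_shatters (hNIP : IsNIP L M) {k m : ℕ} {D : Set (Fin k ⊕ Fin m → M)}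
    (hD : A.Definable L D) : ∃ N : ℕ, ¬ ∃ (a : Fin N → Fin k → M) (b : Set (Fin N) → Fin m → M),
      ∀ (i : Fin N) (S : Set (Fin N)), Sum.elim (a i) (b S) ∈ D ↔ i ∈ S := by
  obtain ⟨A₀, -, hD⟩ := Set.definable_iff_finitely_definable.1 hD
  obtain ⟨φ, rfl⟩ := Set.definable_iff_exists_formula_sum.1 hD
  obtain ⟨l, ⟨e⟩⟩ := Finite.exists_equiv_fin A₀
  -- The finitely many parameters become `l` extra `y`-variables, held constant in the shattering
  -- family.
  obtain ⟨N, hN⟩ := hNIP k (m + l) (φ.relabel (Sum.elim (fun c => Sum.inr (Fin.natAdd m (e c)))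
    (Sum.elim Sum.inl fun j => Sum.inr (Fin.castAdd l j))))
  refine ⟨N, fun ⟨a, b, hab⟩ => hN ⟨a, fun S => Fin.append (b S) fun j => e.symm j, fun i S => ?_⟩⟩
  rw [← hab i S, Formula.realize_relabel]
  refine iff_of_eq (congrArg φ.Realize ?_)
  ext (c | j | j) <;> simp

end Saturation
end NIPField

namespace NIPField

/-! ### Moore matrices and residues modulo the Artin–Schreier image -/

section Algebra

open Polynomial

/-- The Moore matrix of an `𝔽_p`-linearly independent family is invertible. -/
theorem exists_sum_mul_pow_eq {p : ℕ} [Fact p.Prime] {K : Type*} [Field K] [Algebra (ZMod p) K]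
    {N : ℕ} {β : Fin N → K} (hβ : LinearIndependent (ZMod p) β) (e : Fin N → K) :
    ∃ c : Fin N → K, ∀ j, ∑ k, c k * β j ^ p ^ (k : ℕ) = e j := by
  have : CharP K p := charP_of_injective_algebraMap (algebraMap (ZMod p) K).injective p
  have hp : 1 < p := (Fact.out : p.Prime).one_lt
  let T : (Fin N → K) →ₗ[K] (Fin N → K) :=
    { toFun := fun c j => ∑ k, c k * β j ^ p ^ (k : ℕ)
      map_add' := fun c d => by ext j; simp [add_mul, Finset.sum_add_distrib]
      map_smul' := fun r c => by ext j; simp [mul_assoc, Finset.mul_sum] }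
  suffices h : Function.Injective T by
    obtain ⟨c, hc⟩ := LinearMap.injective_iff_surjective.1 h e
    exact ⟨c, fun j => congrFun hc j⟩
  rw [injective_iff_map_eq_zero]
  intro c hc
  -- This polynomial is additive, so for `c` in the kernel it vanishes on the whole `𝔽_p`-span of
  -- `β`: `p ^ N` roots, against degree at most `p ^ (N - 1)`.
  let P : K[X] := ∑ k : Fin N, C (c k) * X ^ p ^ (k : ℕ)
  have hroot : ∀ r : Fin N → ZMod p, P.eval (∑ j, r j • β j) = 0 := by
    intro r
    have h1 : ∀ k : ℕ, (∑ j, r j • β j) ^ p ^ k = ∑ j, r j • β j ^ p ^ k := by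
      intro k
      rw [sum_pow_char_pow]
      refine Finset.sum_congr rfl fun j _ => ?_
      rw [_root_.smul_pow, ZMod.pow_card_pow]
    have h2 : P.eval (∑ j, r j • β j) = ∑ j, r j • T c j := by
      simp only [P, eval_finsetSum, eval_mul, eval_C, eval_pow, eval_X, h1]
      simp only [T, LinearMap.coe_mk, AddHom.coe_mk, Finset.smul_sum, Finset.mul_sum, mul_smul_comm]
      exact Finset.sum_comm
    rw [h2, hc]
    simp
  have hP : P = 0 := by
    refine eq_zero_of_natDegree_lt_card_of_eval_eq_zero P
      (f := fun r : Fin N → ZMod p => ∑ j, r j • β j)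
      ?_ hroot ?_
    · exact linearIndependent_iff_injective_fintypeLinearCombination.1 hβ
    rw [Fintype.card_pi_const, ZMod.card]
    rcases N with _ | N
    · simp [P]
    · refine lt_of_le_of_lt (natDegree_sum_le_of_forall_le (n := p ^ N) _ _ fun k _ => ?_)
        (Nat.pow_lt_pow_right hp N.lt_succ_self)
      exact (natDegree_C_mul_X_pow_le _ _).trans
        (Nat.pow_le_pow_right hp.le (Nat.le_of_lt_succ k.2))
  ext k
  have := congrArg (fun Q : K[X] => Q.coeff (p ^ (k : ℕ))) hP
  simpa [P, finsetSum_coeff, coeff_X_pow, Nat.pow_right_inj hp, Fin.val_inj] using this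

/-- The image of `x ↦ x ^ p - x`. -/
def artinSchreierRange (p : ℕ) (K : Type*) [Field K] [ExpChar K p] : AddSubgroup K :=
  ((frobenius K p : K →+ K) - AddMonoidHom.id K).range

theorem mem_artinSchreierRange {p : ℕ} {K : Type*} [Field K] [ExpChar K p] {y : K} :
    y ∈ artinSchreierRange p K ↔ ∃ x : K, x ^ p - x = y :=
  Iff.rfl

theorem pow_pow_sub_mem_artinSchreierRange {p : ℕ} {K : Type*} [Field K] [ExpChar K p] (x : K)
    (k : ℕ) : x ^ p ^ k - x ∈ artinSchreierRange p K := by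
  induction k with
  | zero => simp
  | succ k ih =>
    have h : (x ^ p ^ k) ^ p - x ^ p ^ k ∈ artinSchreierRange p K := ⟨_, rfl⟩
    rw [pow_succ, pow_mul]
    simpa using add_mem h ih

/-- In an infinite field of characteristic `p`, multiplication modulo the image of `x ^ p - x`
realizes all patterns of `0` and `u`. -/
theorem exists_mul_sub_mem_artinSchreierRange {p : ℕ} [Fact p.Prime] (K : Type*) [Field K]
    [CharP K p] [Infinite K] (N : ℕ) : ∃ b : Fin N → K, ∀ e : Fin N → K,
      ∃ t : K, ∀ j, b j * t - e j ∈ artinSchreierRange p K := by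
  let : Algebra (ZMod p) K := ZMod.algebra K p
  have hrank : (N : Cardinal) ≤ Module.rank (ZMod p) K := by
    refine Cardinal.natCast_le_aleph0.trans ?_
    by_contra h
    have : Module.Finite (ZMod p) K := Module.rank_lt_aleph0_iff.1 (not_le.1 h)
    exact Infinite.not_finite (α := K) (Module.finite_of_finite (ZMod p))
  obtain ⟨β, hβ⟩ := Module.le_rank_iff.1 hrank
  -- With this `b` and the `t` below, `b j * t` is the sum of the `(c k * β j ^ p ^ k) ^ p ^ (N -
  -- k)`; modulo `H` the outer powers drop out, leaving the Moore system with value `e j`.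
  refine ⟨fun j => β j ^ p ^ N, fun e => ?_⟩
  obtain ⟨c, hc⟩ := exists_sum_mul_pow_eq hβ e
  refine ⟨∑ k, c k ^ p ^ (N - (k : ℕ)), fun j => ?_⟩
  rw [← hc j, Finset.mul_sum, ← Finset.sum_sub_distrib]
  refine sum_mem fun k _ => ?_
  have : β j ^ p ^ N = (β j ^ p ^ (k : ℕ)) ^ p ^ (N - (k : ℕ)) := by
    rw [← pow_mul, ← pow_add, Nat.add_sub_cancel' k.2.le]
  dsimp only
  rw [this, ← mul_pow, mul_comm (c k)]
  exact pow_pow_sub_mem_artinSchreierRange _ _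

/-- Two roots of `X ^ p - X - c` differ by an element fixed by Frobenius, hence by an element of the
prime field. -/
theorem mem_range_algebraMap_of_pow_sub_self_mem {p : ℕ} [Fact p.Prime] {K E : Type*} [Field K]
    [Field E] [CharP K p] [Algebra K E] (h : Function.Surjective fun x : K => x ^ p - x) {α : E}
    (hα : α ^ p - α ∈ (algebraMap K E).range) : α ∈ (algebraMap K E).fieldRange := by
  have : CharP E p := charP_of_injective_algebraMap (algebraMap K E).injective p
  obtain ⟨c, hc⟩ := hα
  obtain ⟨x, rfl⟩ := h c
  have h0 : (α - algebraMap K E x) ^ p = α - algebraMap K E x := by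
    rw [sub_pow_char]
    simp only [map_sub, map_pow] at hc
    linear_combination -hc
  have h1 : α - algebraMap K E x ∈ (algebraMap K E).fieldRange :=
    (bot_le : ⊥ ≤ (algebraMap K E).fieldRange) ((Subfield.mem_bot_iff_pow_eq_self E p).2 h0)
  simpa using add_mem h1 (⟨x, rfl⟩ : algebraMap K E x ∈ (algebraMap K E).fieldRange)

end Algebra
end NIPField

namespace NIPField
open FirstOrder FirstOrder.Language Cardinal

/-! ### Type-definable relations on the field, and the contradiction with NIP -/

section TypeDefinableRelations

variable {L : FirstOrder.Language.{u, v}} {M : Type w} [L.Structure M] {κ : Cardinal.{w}}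
  {A B : Set M} {n : ℕ} {K : Set (Fin n → M)} {ι ι' : Type*}

/-- A tuple of elements of `K ⊆ Mⁿ`, as a single tuple of elements of `M`. -/
def flatten (x : ι → K) : ι × Fin n → M := fun i => (x i.1 : Fin n → M) i.2

theorem flatten_injective : Function.Injective (flatten : (ι → K) → ι × Fin n → M) :=
  fun _ _ h => funext fun i => Subtype.ext (funext fun j => congrFun h (i, j))

/-- A relation on `K ⊆ Mⁿ` is type-definable over `A`. -/
def RelTypeDefinable (L : FirstOrder.Language.{u, v}) [L.Structure M] (A : Set M)
    (R : Set (ι → K)) : Prop :=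
  TypeDefinable L A (flatten '' R)

theorem RelTypeDefinable.inter {R S : Set (ι → K)} (hR : RelTypeDefinable L A R)
    (hS : RelTypeDefinable L A S) : RelTypeDefinable L A (R ∩ S) := by
  unfold RelTypeDefinable
  rw [Set.image_inter flatten_injective]
  exact TypeDefinable.inter hR hS

theorem relTypeDefinable_univ (hK : TypeDefinable L A K) :
    RelTypeDefinable L A (Set.univ : Set (ι → K)) := by
  have : flatten '' (Set.univ : Set (ι → K)) =
      ⋂ i : ι, (fun g : ι × Fin n → M => g ∘ Prod.mk i) ⁻¹' K := by
    ext g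
    simp only [Set.image_univ, Set.mem_range, Set.mem_iInter, Set.mem_preimage]
    refine ⟨?_, fun h => ⟨fun i => ⟨_, h i⟩, rfl⟩⟩
    rintro ⟨x, rfl⟩ i
    exact (x i).2
  rw [RelTypeDefinable, this]
  exact TypeDefinable.iInter fun i => hK.preimage_comp _

theorem RelTypeDefinable.preimage_comp (hK : TypeDefinable L A K) {R : Set (ι → K)}
    (hR : RelTypeDefinable L A R) (f : ι → ι') :
    RelTypeDefinable L A {x : ι' → K | x ∘ f ∈ R} := by
  have : flatten '' {x : ι' → K | x ∘ f ∈ R} =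
      flatten '' (Set.univ : Set (ι' → K)) ∩
        (fun g : ι' × Fin n → M => g ∘ Prod.map f id) ⁻¹' (flatten '' R) := by
    ext g
    constructor
    · rintro ⟨x, hx, rfl⟩
      exact ⟨⟨x, trivial, rfl⟩, x ∘ f, hx, rfl⟩
    · rintro ⟨⟨x, -, rfl⟩, y, hy, hxy⟩
      have hxy : flatten y = flatten (x ∘ f) := hxy
      obtain rfl := flatten_injective hxy
      exact ⟨x, hy, rfl⟩
  rw [RelTypeDefinable, this]
  exact TypeDefinable.inter (relTypeDefinable_univ hK)
    (TypeDefinable.preimage_comp hR _)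

theorem RelTypeDefinable.image_comp (hsat : IsSaturated L M κ) (hκ : ℵ₀ ≤ κ) (hA : #A < κ)
    [Finite ι] [Finite ι'] {R : Set (ι → K)} (hR : RelTypeDefinable L A R) (f : ι' → ι) :
    RelTypeDefinable L A ((fun x : ι → K => x ∘ f) '' R) := by
  have := hsat.typeDefinable_image_comp hκ hA hR (Prod.map f (id : Fin n → Fin n))
  rw [Set.image_image] at this
  rwa [RelTypeDefinable, Set.image_image]

theorem relTypeDefinable_apply_eq (hK : TypeDefinable L A K) (c : K)
    (hc : Set.range (c : Fin n → M) ⊆ A) (i : ι) :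
    RelTypeDefinable L A {x : ι → K | x i = c} := by
  have : flatten '' {x : ι → K | x i = c} = flatten '' (Set.univ : Set (ι → K)) ∩
      ⋂ j : Fin n, {g : ι × Fin n → M | g (i, j) = (c : Fin n → M) j} := by
    ext g
    simp only [Set.mem_inter_iff, Set.mem_iInter]
    constructor
    · rintro ⟨x, rfl, rfl⟩
      exact ⟨⟨x, trivial, rfl⟩, fun j => rfl⟩
    · rintro ⟨⟨x, -, rfl⟩, h⟩
      exact ⟨x, Subtype.ext (funext h), rfl⟩
  rw [RelTypeDefinable, this]
  exact TypeDefinable.inter (relTypeDefinable_univ hK)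
    (TypeDefinable.iInter fun j => (definable_setOf_apply_eq (hc ⟨j, rfl⟩) _).typeDefinable)

theorem relTypeDefinable_op (hK : TypeDefinable L A K) {f : K → K → K}
    (hf : TypeDefinable L A (opGraph f)) (i j k : ι) :
    RelTypeDefinable L A {x : ι → K | f (x i) (x j) = x k} := by
  have : flatten '' {x : ι → K | f (x i) (x j) = x k} = flatten '' (Set.univ : Set (ι → K)) ∩
      (fun g : ι × Fin n → M => g ∘ Sum.elim (Prod.mk i) (Sum.elim (Prod.mk j) (Prod.mk k))) ⁻¹'
        opGraph f := by
    ext g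
    constructor
    · rintro ⟨x, hx, rfl⟩
      refine ⟨⟨x, trivial, rfl⟩, x i, x j, ?_⟩
      rw [show f (x i) (x j) = x k from hx]
      ext (l | l | l) <;> rfl
    · rintro ⟨⟨x, -, rfl⟩, y, z, h⟩
      have hy : x i = y := Subtype.ext (funext fun l => congrFun h (Sum.inl l))
      have hz : x j = z := Subtype.ext (funext fun l => congrFun h (Sum.inr (Sum.inl l)))
      have hyz : x k = f y z := Subtype.ext (funext fun l => congrFun h (Sum.inr (Sum.inr l)))
      exact ⟨x, by simp [hy, hz, hyz], rfl⟩
  rw [RelTypeDefinable, this]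
  exact TypeDefinable.inter (relTypeDefinable_univ hK)
    (hf.preimage_comp _)

variable [Field K]

theorem IsTypeDefinableField.mono (hK : IsTypeDefinableField L A K) (h : A ⊆ B) :
    IsTypeDefinableField L B K :=
  ⟨hK.carrier.mono h, hK.add_graph.mono h, hK.mul_graph.mono h⟩

/-- Each multiplication quantifies out the previous power. Starting at the square avoids the
degenerate exponents, and a prime is at least `2`. -/
theorem IsTypeDefinableField.relTypeDefinable_pow (hK : IsTypeDefinableField L A K)
    (hsat : IsSaturated L M κ) (hκ : ℵ₀ ≤ κ) (hA : #A < κ) (m : ℕ) (i j : ι) :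
    RelTypeDefinable L A {x : ι → K | x i ^ (m + 2) = x j} := by
  suffices h : RelTypeDefinable L A {x : Fin 2 → K | x 0 ^ (m + 2) = x 1} from
    h.preimage_comp hK.carrier ![i, j]
  induction m with
  | zero =>
    simpa [sq] using relTypeDefinable_op hK.carrier hK.mul_graph (0 : Fin 2) 0 1
  | succ m ih =>
    convert (((ih.preimage_comp hK.carrier (![0, 2] : Fin 2 → Fin 3)).inter
      (relTypeDefinable_op hK.carrier hK.mul_graph (2 : Fin 3) 0 1)).image_comp hsat hκ hA
        (![0, 1] : Fin 2 → Fin 3)) using 1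
    ext x
    constructor
    · intro hx
      exact ⟨![x 0, x 1, x 0 ^ (m + 2)], ⟨rfl, by simpa [pow_succ] using hx⟩,
        by ext i; fin_cases i <;> rfl⟩
    · rintro ⟨y, ⟨hy, hy'⟩, rfl⟩
      have hy : y 0 ^ (m + 2) = y 2 := hy
      have hy' : y 2 * y 0 = y 1 := hy'
      change y 0 ^ (m + 1 + 2) = y 1
      rw [← hy', ← hy]
      ring

/-- The relation `b * t ∈ u + H`, for `H` the image of `x ↦ x ^ p - x`. -/
def artinSchreierCoset (p : ℕ) (u : K) : Set (Fin 2 → K) :=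
  {x | ∃ r : K, r ^ p - r + u = x 0 * x 1}

theorem IsTypeDefinableField.relTypeDefinable_artinSchreierCoset (hK : IsTypeDefinableField L A K)
    (hsat : IsSaturated L M κ) (hκ : ℵ₀ ≤ κ) (hA : #A < κ) {p : ℕ} (hp : 2 ≤ p) (c : K)
    (hc : Set.range (c : Fin n → M) ⊆ A) : RelTypeDefinable L A (artinSchreierCoset p c) := by
  obtain ⟨m, rfl⟩ := Nat.exists_eq_add_of_le' hp
  -- The seven coordinates are `b, t, b * t, r, r ^ p, c, r ^ p + c`; subtraction is avoided by
  -- writing the condition as `b * t + r = r ^ p + c`.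
  convert ((((((relTypeDefinable_op hK.carrier hK.mul_graph (0 : Fin 7) 1 2).inter
    (relTypeDefinable_op hK.carrier hK.add_graph (2 : Fin 7) 3 6)).inter
    (relTypeDefinable_op hK.carrier hK.add_graph (4 : Fin 7) 5 6)).inter
    (relTypeDefinable_apply_eq hK.carrier c hc (5 : Fin 7))).inter
    (hK.relTypeDefinable_pow hsat hκ hA m (3 : Fin 7) 4)).image_comp hsat hκ hA
      (![0, 1] : Fin 2 → Fin 7)) using 1
  ext x
  constructor
  · rintro ⟨r, hr⟩
    refine ⟨![x 0, x 1, x 0 * x 1, r, r ^ (m + 2), c, r ^ (m + 2) + c],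
      ⟨⟨⟨⟨rfl, ?_⟩, rfl⟩, rfl⟩, rfl⟩, by ext i; fin_cases i <;> rfl⟩
    change x 0 * x 1 + r = r ^ (m + 2) + c
    rw [← hr]
    ring
  · rintro ⟨y, ⟨⟨⟨⟨h₁, h₂⟩, h₃⟩, h₄⟩, h₅⟩, rfl⟩
    refine ⟨y 3, ?_⟩
    have h₁ : y 0 * y 1 = y 2 := h₁
    have h₂ : y 2 + y 3 = y 6 := h₂
    have h₃ : y 4 + y 5 = y 6 := h₃
    have h₄ : y 5 = c := h₄
    have h₅ : y 3 ^ (m + 2) = y 4 := h₅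
    change y 3 ^ (m + 2) - y 3 + c = y 0 * y 1
    rw [h₁, h₅, ← h₄]
    linear_combination h₃ - h₂

theorem IsTypeDefinableField.surjective_pow_sub (hK : IsTypeDefinableField L A K)
    (hsat : IsSaturated L M κ) (hNIP : IsNIP L M) (hκ : ℵ₀ ≤ κ) (hA : #A < κ) [Infinite K] {p : ℕ}
    [Fact p.Prime] [CharP K p] : Function.Surjective fun x : K => x ^ p - x := by
  by_contra! hsurj
  simp only [Function.Surjective, not_forall] at hsurj
  obtain ⟨u, hu⟩ := hsurj
  -- Both cosets must be type-definable over one small set, so the coordinates of `u` and `0` are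
  -- added.
  set B : Set M := (A ∪ Set.range (u : Fin n → M)) ∪ Set.range ((0 : K) : Fin n → M)
  have hAB : A ⊆ B := Set.subset_union_left.trans Set.subset_union_left
  have hBκ : #B < κ := mk_union_range_lt hκ (mk_union_range_lt hκ hA _) _
  have hp : 2 ≤ p := (Fact.out : p.Prime).two_le
  have hcoset : ∀ c : K, Set.range (c : Fin n → M) ⊆ B →
      RelTypeDefinable L B (artinSchreierCoset p c) :=
    fun c hc => (hK.mono hAB).relTypeDefinable_artinSchreierCoset hsat hκ hBκ hp c hc
  have hdisj : Disjoint (flatten '' artinSchreierCoset p u)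
      (flatten '' artinSchreierCoset p (0 : K)) := by
    rw [Set.disjoint_image_iff flatten_injective, Set.disjoint_left]
    rintro x ⟨r, hr⟩ ⟨s, hs⟩
    refine hu ⟨s - r, ?_⟩
    simp only [sub_pow_char]
    linear_combination hs - hr
  obtain ⟨D, hD, huD, hD0⟩ := hsat.exists_definable_separating hBκ
    (hcoset u (Set.subset_union_right.trans Set.subset_union_left))
    (hcoset 0 Set.subset_union_right) hdisj
  obtain ⟨N, hN⟩ := hNIP.exists_not_shatters (hD.preimage_comp
    fun i : Fin 2 × Fin n => (![Sum.inl i.2, Sum.inr i.2] : Fin 2 → Fin n ⊕ Fin n) i.1)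
  apply hN
  classical
  obtain ⟨b, hb⟩ := exists_mul_sub_mem_artinSchreierRange (p := p) K N
  choose t ht using fun S : Set (Fin N) => hb fun j => if j ∈ S then u else 0
  refine ⟨fun i => b i, fun S => t S, fun i S => ?_⟩
  have hflat : (Sum.elim (b i : Fin n → M) (t S : Fin n → M) ∘
      fun i : Fin 2 × Fin n => (![Sum.inl i.2, Sum.inr i.2] : Fin 2 → Fin n ⊕ Fin n) i.1) =
      flatten ![b i, t S] := by
    ext ⟨j, l⟩
    fin_cases j <;> rfl
  rw [Set.mem_preimage, hflat]
  obtain ⟨r, hr⟩ := mem_artinSchreierRange.1 (ht S i)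
  by_cases hi : i ∈ S
  · refine iff_of_true (huD ⟨_, ⟨r, ?_⟩, rfl⟩) hi
    simp [hr, hi]
  · refine iff_of_false (fun h => Set.disjoint_left.1 hD0 h ⟨_, ⟨r, ?_⟩, rfl⟩) hi
    simp [hr, hi]

end TypeDefinableRelations
end NIPField

theorem mainTheorem1 (L : FirstOrder.Language.{u, v}) (M : Type w) [L.Structure M]
    (κ : Cardinal.{w}) (hκ : Cardinal.aleph0 ≤ κ)
    (hsat : NIPField.IsSaturated L M κ) (hNIP : NIPField.IsNIP L M)
    (A : Set M) (hA : Cardinal.mk A < κ)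
    (n : ℕ) (K : Set (Fin n → M)) [Field K]
    (hK : NIPField.IsTypeDefinableField L A K) [Infinite K]
    (p : ℕ) (hp : 0 < p) [CharP K p] :
    NIPField.IsArtinSchreierClosed p K ∧ Function.Surjective (fun x : K => x ^ p - x) := by
  have : Fact p.Prime := ⟨(CharP.char_is_prime_or_zero K p).resolve_right hp.ne'⟩
  have hsurj : Function.Surjective (fun x : K => x ^ p - x) :=
    hK.surjective_pow_sub hsat hNIP hκ hA
  refine ⟨fun E _ _ α hα => ?_, hsurj⟩
  rw [IntermediateField.adjoin_simple_eq_bot_iff, IntermediateField.mem_bot]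
  exact NIPField.mem_range_algebraMap_of_pow_sub_self_mem hsurj hα
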